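/- Let $n,d\ge 1$ be integers, let $(z_{j,k})\in\mathbb{C}^{n\times d}$, and let $x_1,\dots,x_d$ be algebraically independent commuting indeterminates over $\mathbb{C}$. Let $m=(m_1,\dots,m_d)\in\mathbb{Z}_{\ge 0}^d$ with $m_1+\dots+m_d=n$, and write $m!=\prod_{k=1}^d m_k!$ and $x^m=\prod_{k=1}^d x_k^{m_k}$. Denote by $[x^m]f$ the coefficient of $x^m$ in a polynomial $f\in\mathbb{C}[x_1,\dots,x_d]$. Then $$\Bigl|\,[x^m]\prod_{j=1}^n\Bigl(\sum_{k=1}^d z_{j,k}x_k\Bigr)\Bigr|\;\le\;\frac{n!}{m!}\prod_{k=1}^d\Bigl(\binom{n}{m_k}^{-1}\sum_{I\subseteq\{1,\dots,n\},\ |I|=m_k}\ \prod_{j\in I}|z_{j,k}|^2\Bigr)^{1/2}.$$ -/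

import Mathlib

/-! Induct on the rows. Expanding along a new row `a` writes the coefficient at `m` as a sum over
`k` of `z a k` times the old coefficient at `m - e_k`. After the induction hypothesis, the
factorials leave the weights `m k / (s.card + 1)`, which sum to 1. The same weights govern how the
symmetric means grow with a row (`symmMean_insert`), so the step reduces to a real inequality for
convex weights, `sum_mul_prod_erase_le_prod_sqrt`. -/

/-- If `α ≥ 0` has total mass `σ ≤ 1`, then `∏ ((1 - α k) y k² + α k x k²)` dominates
`(1 - σ) Y² + σ X²`, where `Y = ∏ y k` and `σ X = ∑ α k x k ∏_{l ≠ k} y l`. -/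
theorem exists_weightedMean_sq_le_prod {κ : Type*} [DecidableEq κ] (α x y : κ → ℝ)
    (s : Finset κ) (hα : ∀ k ∈ s, 0 ≤ α k) (hs : ∑ k ∈ s, α k ≤ 1) :
    ∃ X : ℝ, ∑ k ∈ s, α k * x k * ∏ l ∈ s.erase k, y l = (∑ k ∈ s, α k) * X ∧
      (1 - ∑ k ∈ s, α k) * (∏ k ∈ s, y k) ^ 2 + (∑ k ∈ s, α k) * X ^ 2 ≤
        ∏ k ∈ s, ((1 - α k) * y k ^ 2 + α k * x k ^ 2) := by
  induction s using Finset.induction_on with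
  | empty => exact ⟨0, by simp, by simp⟩
  | insert a s ha ih =>
    have hαs : ∀ k ∈ s, 0 ≤ α k := fun k hk => hα k (Finset.mem_insert_of_mem hk)
    have hβ : 0 ≤ α a := hα a (Finset.mem_insert_self a s)
    have hσ : 0 ≤ ∑ k ∈ s, α k := Finset.sum_nonneg hαs
    rw [Finset.sum_insert ha] at hs
    obtain ⟨X, hX, hP⟩ := ih hαs (by linarith)
    have hW : ∑ k ∈ insert a s, α k * x k * ∏ l ∈ (insert a s).erase k, y l =
        α a * x a * ∏ l ∈ s, y l + (∑ k ∈ s, α k) * X * y a := by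
      rw [Finset.sum_insert ha, Finset.erase_insert ha, ← hX, Finset.sum_mul]
      congr 1
      refine Finset.sum_congr rfl fun k hk => ?_
      have hak : a ≠ k := fun h => ha (h ▸ hk)
      rw [Finset.erase_insert_of_ne hak,
        Finset.prod_insert (fun h => ha (Finset.mem_of_mem_erase h))]
      ring
    rw [hW, Finset.sum_insert ha, Finset.prod_insert ha, Finset.prod_insert ha]
    generalize ∑ k ∈ s, α k = σ at *
    generalize ∏ k ∈ s, y k = Y at *
    generalize ∏ k ∈ s, ((1 - α k) * y k ^ 2 + α k * x k ^ 2) = P at *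
    generalize α a = β at *
    have hfac : 0 ≤ (1 - β) * y a ^ 2 + β * x a ^ 2 :=
      add_nonneg (mul_nonneg (by linarith) (sq_nonneg _)) (mul_nonneg hβ (sq_nonneg _))
    have hmul := mul_le_mul_of_nonneg_left hP hfac
    -- With total mass zero the mean is undefined, and any `X` will do.
    rcases (add_nonneg hβ hσ).eq_or_lt with h0 | hpos
    · obtain rfl : β = 0 := by linarith
      obtain rfl : σ = 0 := by linarith
      exact ⟨0, by simp, le_trans (le_of_eq (by ring)) hmul⟩
    · refine ⟨(β * x a * Y + σ * X * y a) / (β + σ), by field_simp, le_trans ?_ hmul⟩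
      -- This is exactly the gap between the factor for `a` times the inductive lower bound and the
      -- new lower bound.
      have hbr : 0 ≤ σ * β / (β + σ) * ((1 - (β + σ)) * (X * y a - x a * Y) ^ 2 +
          (β + σ) * (X * x a - Y * y a) ^ 2) :=
        mul_nonneg (div_nonneg (mul_nonneg hσ hβ) hpos.le)
          (add_nonneg (mul_nonneg (by linarith) (sq_nonneg _))
            (mul_nonneg hpos.le (sq_nonneg _)))
      rw [← sub_nonneg]
      refine le_of_le_of_eq hbr ?_
      field_simp
      ring

/-- At total mass 1 the `Y ^ 2` term drops out and `X` is the whole left side. Mass below 1 is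
needed only for the induction over partial sums. -/
theorem sum_mul_prod_erase_le_prod_sqrt {κ : Type*} [Fintype κ] [DecidableEq κ]
    (α x y : κ → ℝ) (hα : ∀ k, 0 ≤ α k) (hs : ∑ k, α k = 1) :
    ∑ k, α k * x k * ∏ l ∈ Finset.univ.erase k, y l ≤
      ∏ k, √((1 - α k) * y k ^ 2 + α k * x k ^ 2) := by
  obtain ⟨X, hX, hP⟩ :=
    exists_weightedMean_sq_le_prod α x y Finset.univ (fun k _ => hα k) hs.le
  have hle : ∀ k, α k ≤ 1 := fun k =>
    hs ▸ Finset.single_le_sum (fun l _ => hα l) (Finset.mem_univ k)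
  rw [← Real.sqrt_prod _ fun k _ => add_nonneg
    (mul_nonneg (sub_nonneg.2 (hle k)) (sq_nonneg _)) (mul_nonneg (hα k) (sq_nonneg _))]
  refine Real.le_sqrt_of_sq_le ?_
  rw [hX, hs, one_mul]
  simpa [hs] using hP

/-- The normalized elementary symmetric mean of degree `k` of the values `w j`, `j ∈ s`. -/
noncomputable def symmMean {ι : Type*} (s : Finset ι) (w : ι → ℝ) (k : ℕ) : ℝ :=
  (1 / (Nat.choose s.card k : ℝ)) * ∑ I ∈ Finset.powersetCard k s, ∏ j ∈ I, w j

theorem symmMean_nonneg {ι : Type*} (s : Finset ι) {w : ι → ℝ} (hw : ∀ j, 0 ≤ w j) (k : ℕ) :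
    0 ≤ symmMean s w k :=
  mul_nonneg (by positivity) (Finset.sum_nonneg fun _ _ => Finset.prod_nonneg fun j _ => hw j)

/-- A uniformly random `k`-subset of `insert a s` contains `a` with probability `k / (s.card + 1)`;
condition on this event. -/
theorem symmMean_insert {ι : Type*} [DecidableEq ι] {s : Finset ι} {a : ι} (ha : a ∉ s)
    (w : ι → ℝ) {k : ℕ} (hk : k ≤ s.card + 1) :
    symmMean (insert a s) w k =
      (1 - (k : ℝ) / (s.card + 1)) * symmMean s w k +
        (k : ℝ) / (s.card + 1) * (w a * symmMean s w (k - 1)) := by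
  rcases k with _ | i
  · simp [symmMean]
  have hsum : ∑ I ∈ Finset.powersetCard (i + 1) (insert a s), ∏ j ∈ I, w j =
      ∑ I ∈ Finset.powersetCard (i + 1) s, ∏ j ∈ I, w j +
        w a * ∑ I ∈ Finset.powersetCard i s, ∏ j ∈ I, w j := by
    have hmem : ∀ I ∈ Finset.powersetCard i s, a ∉ I := fun I hI h =>
      ha ((Finset.mem_powersetCard.1 hI).1 h)
    rw [Finset.powersetCard_succ_insert ha, Finset.sum_union, Finset.sum_image, Finset.mul_sum]
    · congr 1
      exact Finset.sum_congr rfl fun I hI => Finset.prod_insert (hmem I hI)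
    · intro I hI J hJ h
      rw [← Finset.erase_insert (hmem I hI), ← Finset.erase_insert (hmem J hJ)]
      exact congrArg (fun K => Finset.erase K a) h
    · refine Finset.disjoint_left.2 fun I hI hJ => ?_
      obtain ⟨J, -, rfl⟩ := Finset.mem_image.1 hJ
      exact ha ((Finset.mem_powersetCard.1 hI).1 (Finset.mem_insert_self a J))
  have hin : i ≤ s.card := by omega
  have hc0 : ((s.card.choose i : ℕ) : ℝ) ≠ 0 := by exact_mod_cast (Nat.choose_pos hin).ne'
  have hc1 : (((s.card + 1).choose (i + 1) : ℕ) : ℝ) ≠ 0 := by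
    exact_mod_cast (Nat.choose_pos hk).ne'
  have hn : ((s.card : ℝ) + 1) ≠ 0 := by positivity
  have e1 : ((s.card : ℝ) + 1) * (s.card.choose i : ℝ) =
      ((s.card + 1).choose (i + 1) : ℝ) * (i + 1) := by
    exact_mod_cast Nat.add_one_mul_choose_eq s.card i
  simp only [symmMean, hsum, Finset.card_insert_of_notMem ha, Nat.add_sub_cancel]
  have hB : (((i + 1 : ℕ) : ℝ) / (s.card + 1)) * (1 / (s.card.choose i : ℝ)) =
      1 / ((s.card + 1).choose (i + 1) : ℝ) := by
    push_cast
    field_simp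
    linear_combination -e1
  -- If `i = s.card`, every `(i + 1)`-subset contains `a`: the sum over subsets of `s` is empty.
  rcases hin.eq_or_lt with rfl | hlt
  · rw [Finset.powersetCard_eq_empty.2 (Nat.lt_succ_self _), Finset.sum_empty, ← hB]
    ring
  · have hc2 : ((s.card.choose (i + 1) : ℕ) : ℝ) ≠ 0 := by
      exact_mod_cast (Nat.choose_pos hlt).ne'
    have e2 : ((s.card + 1).choose (i + 1) : ℝ) =
        (s.card.choose i : ℝ) + (s.card.choose (i + 1) : ℝ) := by
      exact_mod_cast Nat.choose_succ_succ s.card i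
    have hA : (1 - ((i + 1 : ℕ) : ℝ) / (s.card + 1)) * (1 / (s.card.choose (i + 1) : ℝ)) =
        1 / ((s.card + 1).choose (i + 1) : ℝ) := by
      push_cast
      field_simp
      linear_combination e1 + ((s.card : ℝ) + 1) * e2
    rw [mul_add]
    nth_rewrite 1 [← hA]
    rw [← hB]
    ring

theorem norm_coeff_prod_linear_le {ι κ : Type*} [Fintype κ] (z : ι → κ → ℂ) (s : Finset ι)
    (m : κ →₀ ℕ) (hm : ∑ k, m k = s.card) :
    ‖MvPolynomial.coeff m
        (∏ j ∈ s, ∑ k, MvPolynomial.C (z j k) * MvPolynomial.X k)‖ ≤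
      ((Nat.factorial s.card : ℝ) / ∏ k, (Nat.factorial (m k) : ℝ)) *
        ∏ k, √(symmMean s (fun j => ‖z j k‖ ^ 2) (m k)) := by
  classical
  induction s using Finset.induction_on generalizing m with
  | empty =>
    have h0 : m = 0 := by
      ext k
      exact Finset.sum_eq_zero_iff.1 hm k (Finset.mem_univ k)
    subst h0
    simp [symmMean]
  | insert a s ha ih =>
    rw [Finset.card_insert_of_notMem ha] at hm
    have hn : (0 : ℝ) < (s.card : ℝ) + 1 := by positivity
    have hw : ∀ k, ∀ j, (0 : ℝ) ≤ ‖z j k‖ ^ 2 := fun k j => sq_nonneg _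
    have hmk : ∀ k, m k ≤ s.card + 1 := fun k =>
      hm ▸ Finset.single_le_sum (fun l _ => Nat.zero_le (m l)) (Finset.mem_univ k)
    set E : κ → ℕ → ℝ := fun k i => symmMean s (fun j => ‖z j k‖ ^ 2) i with hE
    have hE0 : ∀ k i, 0 ≤ E k i := fun k i => symmMean_nonneg s (hw k) i
    set p : MvPolynomial κ ℂ := ∏ j ∈ s, ∑ k, MvPolynomial.C (z j k) * MvPolynomial.X k with hp
    have hterm : ∀ k, ‖MvPolynomial.coeff m (MvPolynomial.C (z a k) * MvPolynomial.X k * p)‖ ≤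
        ((Nat.factorial (s.card + 1) : ℝ) / ∏ k, (Nat.factorial (m k) : ℝ)) *
          ((m k : ℝ) / (s.card + 1) * (‖z a k‖ * √(E k (m k - 1))) *
            ∏ l ∈ Finset.univ.erase k, √(E l (m l))) := by
      intro k
      rw [mul_assoc, MvPolynomial.coeff_C_mul, MvPolynomial.coeff_X_mul', norm_mul]
      -- If `m k = 0`, both sides vanish, so the truncated `m k - 1` is harmless.
      by_cases hk : m k = 0
      · simp [hk]
      rw [if_pos (Finsupp.mem_support_iff.2 hk)]
      set m' : κ →₀ ℕ := m - Finsupp.single k 1 with hm'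
      have hself : m' k = m k - 1 := by simp [hm']
      have hother : ∀ l ∈ Finset.univ.erase k, m' l = m l := fun l hl => by
        simp [hm', Finsupp.single_eq_of_ne (Finset.ne_of_mem_erase hl)]
      have hsplit : ∀ f : κ → ℕ, ∑ l, f l = f k + ∑ l ∈ Finset.univ.erase k, f l := fun f =>
        (Finset.add_sum_erase _ f (Finset.mem_univ k)).symm
      have hsum : ∑ l, m' l = s.card := by
        rw [hsplit, hself, Finset.sum_congr rfl hother]
        have hm₂ : m k + ∑ l ∈ Finset.univ.erase k, m l = s.card + 1 := (hsplit m).symm.trans hm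
        change m k - 1 + ∑ l ∈ Finset.univ.erase k, m l = s.card
        omega
      have hprod : ∀ f : κ → ℕ → ℝ, ∏ l ∈ Finset.univ.erase k, f l (m' l) =
          ∏ l ∈ Finset.univ.erase k, f l (m l) := fun f =>
        Finset.prod_congr rfl fun l hl => by rw [hother l hl]
      -- What remains is the identity `n! / (m - e_k)! = ((n + 1)! / m!) * (m k / (n + 1))`, with `n
      -- = s.card`.
      refine (mul_le_mul_of_nonneg_left (ih m' hsum) (norm_nonneg _)).trans (le_of_eq ?_)
      have hfac : ((m k).factorial : ℝ) = (m k : ℝ) * ((m k - 1).factorial : ℝ) := by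
        exact_mod_cast (Nat.mul_factorial_pred hk).symm
      rw [← Finset.mul_prod_erase _ (fun l => ((m' l).factorial : ℝ)) (Finset.mem_univ k),
        ← Finset.mul_prod_erase _ (fun l => ((m l).factorial : ℝ)) (Finset.mem_univ k),
        ← Finset.mul_prod_erase _ (fun l => √(symmMean s (fun j => ‖z j l‖ ^ 2) (m' l)))
          (Finset.mem_univ k),
        hprod fun _ i => (i.factorial : ℝ), hprod fun l i => √(symmMean s (fun j => ‖z j l‖ ^ 2) i),
        hself, hfac, Nat.factorial_succ]
      have hk' : (m k : ℝ) ≠ 0 := by exact_mod_cast hk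
      have h1 : ((m k - 1).factorial : ℝ) ≠ 0 := by positivity
      have h2 : ∏ l ∈ Finset.univ.erase k, ((m l).factorial : ℝ) ≠ 0 :=
        Finset.prod_ne_zero_iff.2 fun l _ => by positivity
      simp only [hE]
      push_cast
      field_simp
    rw [Finset.prod_insert ha, ← hp, Finset.sum_mul, MvPolynomial.coeff_sum,
      Finset.card_insert_of_notMem ha]
    refine (norm_sum_le _ _).trans ((Finset.sum_le_sum fun k _ => hterm k).trans ?_)
    rw [← Finset.mul_sum]
    refine mul_le_mul_of_nonneg_left ?_ (by positivity)
    refine (sum_mul_prod_erase_le_prod_sqrt (fun k => (m k : ℝ) / (s.card + 1))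
      (fun k => ‖z a k‖ * √(E k (m k - 1))) (fun k => √(E k (m k)))
      (fun k => by positivity) ?_).trans (le_of_eq ?_)
    · rw [← Finset.sum_div, div_eq_one_iff_eq hn.ne']
      exact_mod_cast hm
    · refine Finset.prod_congr rfl fun k _ => ?_
      rw [symmMean_insert ha _ (hmk k), mul_pow, Real.sq_sqrt (hE0 _ _), Real.sq_sqrt (hE0 _ _)]

theorem mainTheorem5 (n d : ℕ) (z : Matrix (Fin n) (Fin d) ℂ)
    (m : Fin d →₀ ℕ) (hm : ∑ k, m k = n) :
    ‖MvPolynomial.coeff m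
        (∏ j : Fin n, ∑ k : Fin d, MvPolynomial.C (z j k) * MvPolynomial.X k)‖ ≤
      ((Nat.factorial n : ℝ) / ∏ k : Fin d, (Nat.factorial (m k) : ℝ)) *
        ∏ k : Fin d, Real.sqrt ((1 / (Nat.choose n (m k) : ℝ)) *
          ∑ I ∈ Finset.powersetCard (m k) (Finset.univ : Finset (Fin n)),
            ∏ j ∈ I, ‖z j k‖ ^ 2) := by
  simpa [symmMean] using
    norm_coeff_prod_linear_le (fun j k => z j k) Finset.univ m (by simpa using hm)
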